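/- **Theorem (Soundness of GXW synthesis).** Let $V_{in},V_{out}$ be disjoint finite sets of Boolean variables and let $\phi=\varrho\rightarrow\bigwedge_{m=1}^{k}\eta_m$ be a GXW specification over them. If $\mathcal S$ is the actor-based synchronous-dataflow controller that the synthesis procedure below returns on $\phi$, then $\mathcal S$ *realizes* $\phi$: in each state, each input assignment determines exactly one evaluation cycle of $\mathcal S$ (so $\mathcal S$ acts cycle-wise as a deterministic Mealy machine), and for every input sequence $a=a_0a_1\ldots$ with $a_t\in\mathbf 2^{V_{in}}$ the run of $\mathcal S$ on $a$ produces Boolean outputs $b=b_0b_1\ldots$ with $b_t\in\mathbf 2^{V_{out}}$ such that the $\omega$-word $(a_0b_0)(a_1b_1)\ldots$ satisfies $\phi$. *Specifications.* $\phi^i_{in}$ (resp. $\phi^i_{out}$) denotes an LTL formula in DNF whose literals are $\mathbf X^l v$ or $\neg\mathbf X^l v$ with $l\le i$ and $v\in V_{in}$ (resp. $v\in V_{out}$); $\varrho_{out}$ is $v_{out}$ or $\neg v_{out}$ with $v_{out}\in V_{out}$. $\varrho$ is of the form $\mathbf G\,\phi^0_{in}$ (P6), and each $\eta_m$ has one of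 the forms (P1) $\varrho_{out}\,\mathbf W\,\phi^i_{in}$; (P2) $\mathbf G(\phi^i_{in}\to\mathbf X^i(\varrho_{out}\,\mathbf W\,(\varphi^j_{in}\vee\rho^0_{out})))$; (P3) $\mathbf G(\phi^i_{in}\to\mathbf X^i\varrho_{out})$; (P4) $\mathbf G(\phi^i_{in}\leftrightarrow\mathbf X^i\varrho_{out})$; (P5) $\mathbf G\,\phi^0_{out}$. *Actor systems.* An actor is a finite deterministic Mealy machine with finitely many input and output ports; ports carry $\mathsf{true}$, $\mathsf{false}$ or the don't-care value "–". A controller consists of external input ports (one per $v\in V_{in}$), external output ports (one per $v\in V_{out}$), finitely many actors, and wires such that each actor input port and each external output port is the destination of exactly one wire. In an evaluation cycle the external inputs are read, each wire copies its source to its destination, and each actor executes its machine once. A feedback loop is a directed cycle in the graph whose nodes are the ports and whose edges are the wires and all pairs (input port, output port) of a common actor. *Construction (Steps 1–3).* - *Monitors.* The level-$h$ monitor of a clause $\chi$ over $V_{in}$ (with at most $h$ next operators) has as inputs the variables of $\chi$ and stores the last $h$ values of each of them and of the constant $\mathsf{true}$, all initially "not recorded". Once the constant was recorded $h$ cycles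 ago (always, if $h=0$), its output says whether $\chi$ holds at the position $h$ cycles earlier according to the recorded and current values; before that, the output is $\mathsf{false}$ (and "–" for P4). - *Input part (P1–P4).* One monitor per clause of $\phi^i_{in}$, of level $i$ for P2–P4 and of level the number of next operators of that clause for P1; all are wired to one OR-gate $\mathrm{OR}_m$ (three-valued; "–" if no input is $\mathsf{true}$ and some input is "–"). - *High-level controllers.* For P1–P3, $\mathrm{OR}_m$ is wired to the port $\mathit{input}$ of a new actor. P3, IfTB: output $\mathsf{true}$ if $\mathit{input}$, otherwise "–". P1, InUB: output $\mathsf{true}$ until $\mathit{input}$ is first $\mathsf{true}$, and "–" from that cycle on. P2, TrUB, with state $\mathit{lock}$ (initially $\mathsf{false}$): if $\mathit{release}$, output "–" and $\mathit{lock}:=\mathsf{false}$; else if $\mathit{input}\vee\mathit{lock}$, output $\mathsf{true}$ and $\mathit{lock}:=\mathsf{true}$; else output "–". - *Release part (P2).* The port $\mathit{release}$ is fed by an OR-gate with one input per clause of $\varphi^j_{in}$ and of $\rho^0_{out}$. A clause of $\varphi^j_{in}$ with exactly $h$ next operators gets a level-$h$ monitor, wired directly to the OR-gate if $h=0$ and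 through an actor $\Theta_h$ if $h>0$. $\Theta_h$ has ports $\mathit{set}$ (fed by $\mathrm{OR}_m$) and $\mathit{in}$ (fed by the monitor); it outputs $\mathsf{false}$ before $\mathit{set}$ was first $\mathsf{true}$, and in each cycle with $\mathit{set}=\mathsf{true}$ and the $h-1$ cycles after it; otherwise it outputs $\mathit{in}$. A clause of $\rho^0_{out}$ gets an AND-gate fed by the resolution actors of its variables, through a negation actor for negative literals. - *Resolution.* Each $v\in V_{out}$ has a memoryless resolution actor $Res_v$ with a parameter $A_v\in\{\mathsf{true},\mathsf{false}\}$ and one input for each $\eta_m$ of type P1–P4 whose $\varrho_{out}$ is on $v$. This input is fed by the high-level controller of $\eta_m$ (by $\mathrm{OR}_m$ for P4), through a negation actor (which leaves "–" unchanged) if $\varrho_{out}=\neg v$. $Res_v$ outputs $\mathsf{true}$ if some input is $\mathsf{true}$, else $\mathsf{false}$ if some input is $\mathsf{false}$, else $A_v$; it is wired to the external output port $v$ (and to the AND-gates above). *Parameter synthesis (Step 4).* The procedure returns this controller, with parameters $A=(A_v)_v$, only if it has no feedback loop and $A$ is a witness for the 2QBF formula $\exists A\,\forall\ldots:\Upsilon_a\to\Upsilon_g$.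 Here the universal quantifiers range over all values of the ports (Boolean at the external inputs) and all, not only the reachable, values of the actors' state variables before and after one cycle; $\Upsilon_a$ says that the body $\phi^0_{in}$ of $\varrho$ holds for the inputs and that all wires and all actors' transition relations are respected; $\Upsilon_g$ says that no $Res_v$ receives both $\mathsf{true}$ and $\mathsf{false}$ and that the outputs satisfy the body $\phi^0_{out}$ of every $\eta_m$ of type P5. -/

import Mathlib

namespace GXW

/-! ### Linear temporal logic -/

/-- LTL formulae over a set `α` of Boolean variables. -/
inductive LTL (α : Type) : Type
  | top : LTL α
  | atom : α → LTL α
  | neg : LTL α → LTL α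
  | or : LTL α → LTL α → LTL α
  | and : LTL α → LTL α → LTL α
  | imp : LTL α → LTL α → LTL α
  | G : LTL α → LTL α
  | X : LTL α → LTL α
  | U : LTL α → LTL α → LTL α

namespace LTL

variable {α : Type}

/-- `SatAt σ f t`: the suffix of the ω-word `σ` that starts at position `t` satisfies `f`. -/
def SatAt (σ : ℕ → α → Bool) : LTL α → ℕ → Prop
  | top, _ => True
  | atom a, t => σ t a = true
  | neg f, t => ¬ SatAt σ f t
  | or f g, t => SatAt σ f t ∨ SatAt σ g t
  | and f g, t => SatAt σ f t ∧ SatAt σ g t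
  | imp f g, t => SatAt σ f t → SatAt σ g t
  | G f, t => ∀ s, t ≤ s → SatAt σ f s
  | X f, t => SatAt σ f (t + 1)
  | U f g, t => ∃ s, t ≤ s ∧ SatAt σ g s ∧ ∀ r, t ≤ r → r < s → SatAt σ f r

/-- `σ ⊨ f`. -/
def Sat (σ : ℕ → α → Bool) (f : LTL α) : Prop := SatAt σ f 0

/-- Weak until. -/
def W (f g : LTL α) : LTL α := or (U f g) (G f)

def iff (f g : LTL α) : LTL α := and (imp f g) (imp g f)

/-- `i` consecutive next operators. -/
def XN : ℕ → LTL α → LTL α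
  | 0, f => f
  | i + 1, f => X (XN i f)

def conj (l : List (LTL α)) : LTL α := l.foldr and top

def disj (l : List (LTL α)) : LTL α := l.foldr or (neg top)

end LTL

/-! ### GXW specifications -/

/-- The literal `X^depth var` (if `pos = true`) or `¬ X^depth var` (if `pos = false`). -/
structure Lit (V : Type) : Type where
  depth : ℕ
  var : V
  pos : Bool

/-- A clause formula: the conjunction of a list of literals. -/
abbrev Clause (V : Type) : Type := List (Lit V)

/-- The largest number of consecutive next operators in a clause. -/
def Clause.depth {V : Type} (c : Clause V) : ℕ := (c.map Lit.depth).foldr max 0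

/-- Formulae in disjunctive normal form whose literals have at most `i` next operators. -/
structure DNF (V : Type) (i : ℕ) : Type where
  clauses : List (Clause V)
  bound : ∀ c ∈ clauses, ∀ l ∈ c, l.depth ≤ i

/-- The literal `var` or `¬ var` of an output variable. -/
structure OutLit (V : Type) : Type where
  var : V
  pos : Bool

section toLTL

variable {V α : Type}

def Lit.toLTL (e : V → α) (l : Lit V) : LTL α :=
  if l.pos then LTL.XN l.depth (LTL.atom (e l.var))
  else LTL.neg (LTL.XN l.depth (LTL.atom (e l.var)))

def Clause.toLTL (e : V → α) (c : Clause V) : LTL α := LTL.conj (c.map (Lit.toLTL e))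

def DNF.toLTL {i : ℕ} (e : V → α) (d : DNF V i) : LTL α :=
  LTL.disj (d.clauses.map (Clause.toLTL e))

def OutLit.toLTL (e : V → α) (l : OutLit V) : LTL α :=
  if l.pos then LTL.atom (e l.var) else LTL.neg (LTL.atom (e l.var))

/-- Truth of a formula without next operators under a single assignment. -/
def DNF.Holds (d : DNF V 0) (y : V → Bool) : Prop :=
  ∃ c ∈ d.clauses, ∀ l ∈ c, y l.var = l.pos

end toLTL

/-- The guarantee patterns, over input variables `I` and output variables `O`.
* `P1 ϱ φ`: `ϱ W φ`
* `P2 φ ϱ ϕ ρ`: `G (φ → X^i (ϱ W (ϕ ∨ ρ)))`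
* `P3 φ ϱ`: `G (φ → X^i ϱ)`
* `P4 φ ϱ`: `G (φ ↔ X^i ϱ)`
* `P5 φ`: `G φ` -/
inductive Pattern (I O : Type) : Type
  | P1 {i : ℕ} (out : OutLit O) (inp : DNF I i)
  | P2 {i j : ℕ} (inp : DNF I i) (out : OutLit O) (relIn : DNF I j) (relOut : DNF O 0)
  | P3 {i : ℕ} (inp : DNF I i) (out : OutLit O)
  | P4 {i : ℕ} (inp : DNF I i) (out : OutLit O)
  | P5 (inv : DNF O 0)

inductive Kind : Type
  | p1 | p2 | p3 | p4 | p5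

namespace Pattern

variable {I O : Type}

def toLTL : Pattern I O → LTL (I ⊕ O)
  | P1 out inp => LTL.W (out.toLTL Sum.inr) (inp.toLTL Sum.inl)
  | @P2 _ _ i _ inp out relIn relOut =>
      LTL.G (LTL.imp (inp.toLTL Sum.inl) (LTL.XN i
        (LTL.W (out.toLTL Sum.inr) (LTL.or (relIn.toLTL Sum.inl) (relOut.toLTL Sum.inr)))))
  | @P3 _ _ i inp out => LTL.G (LTL.imp (inp.toLTL Sum.inl) (LTL.XN i (out.toLTL Sum.inr)))
  | @P4 _ _ i inp out => LTL.G (LTL.iff (inp.toLTL Sum.inl) (LTL.XN i (out.toLTL Sum.inr)))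
  | P5 inv => LTL.G (inv.toLTL Sum.inr)

def kind : Pattern I O → Kind
  | P1 .. => .p1
  | P2 .. => .p2
  | P3 .. => .p3
  | P4 .. => .p4
  | P5 .. => .p5

/-- The output literal `ϱ` of a specification of type P1 to P4. -/
def target : Pattern I O → Option (OutLit O)
  | P1 out _ => some out
  | P2 _ out _ _ => some out
  | P3 _ out => some out
  | P4 _ out => some out
  | P5 _ => none

/-- The clauses of the "input" part of a specification of type P1 to P4. -/
def inClauses : Pattern I O → List (Clause I)
  | P1 _ inp => inp.clauses
  | P2 inp _ _ _ => inp.clauses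
  | P3 inp _ => inp.clauses
  | P4 inp _ => inp.clauses
  | P5 _ => []

/-- The number `i` of next operators for which the monitor of a clause of the "input" part is
built. For P2, P3, P4 every clause is padded to the common `i` (that of `X^i` in the pattern); for
P1 no padding takes place. -/
def inLevel : Pattern I O → Clause I → ℕ
  | P1 _ _, c => c.depth
  | @P2 _ _ i _ _ _ _ _, _ => i
  | @P3 _ _ i _ _, _ => i
  | @P4 _ _ i _ _, _ => i
  | P5 _, _ => 0

/-- The clauses over input variables of the "release" part of a specification of type P2. -/
def relInClauses : Pattern I O → List (Clause I)
  | P2 _ _ relIn _ => relIn.clauses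
  | _ => []

/-- The clauses over output variables of the "release" part of a specification of type P2. -/
def relOutClauses : Pattern I O → List (Clause O)
  | P2 _ _ _ relOut => relOut.clauses
  | _ => []

end Pattern

/-- A GXW specification `G assumption → η 1 ∧ … ∧ η k`. -/
structure Spec (I O : Type) : Type where
  assumption : DNF I 0
  k : ℕ
  η : Fin k → Pattern I O

def Spec.toLTL {I O : Type} (φ : Spec I O) : LTL (I ⊕ O) :=
  LTL.imp (LTL.G (φ.assumption.toLTL Sum.inl))
    (LTL.conj (List.ofFn fun m => (φ.η m).toLTL))

/-! ### Actor-based controllers under synchronous dataflow -/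

/-- Values carried by ports during a cycle: `some true`, `some false`, and `none` for the don't-care
value "–" (the set `{true, false}`). -/
abbrev Sig : Type := Option Bool

/-- Finite deterministic Mealy machines with input ports `P` and output ports `Q`. -/
structure Mealy (P Q : Type) : Type 1 where
  State : Type
  finiteState : Finite State
  init : State
  out : State → (P → Sig) → Q → Sig
  next : State → (P → Sig) → State

/-- An actor: finitely many input and output ports, and a Mealy machine on them. -/
structure Actor : Type 1 where
  In : Type
  Out : Type
  finiteIn : Finite In
  finiteOut : Finite Out
  mach : Mealy In Out

/-- An actor-based controller with external input ports `I` and external output ports `O`.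
As every internal input port and every external output port is the destination of exactly one wire,
the wiring is given by the function `wire` from destinations to their sources. -/
structure ActorSystem (I O : Type) : Type 1 where
  Act : Type
  finiteAct : Finite Act
  actor : Act → Actor
  wire : (O ⊕ (Σ x, (actor x).In)) → (I ⊕ (Σ x, (actor x).Out))

namespace ActorSystem

variable {I O : Type} (S : ActorSystem I O)

/-- Ports at which wires start: external input ports and output ports of actors. -/
abbrev Source : Type := I ⊕ (Σ x, (S.actor x).Out)

/-- Ports at which wires end: external output ports and input ports of actors. -/
abbrev Sink : Type := O ⊕ (Σ x, (S.actor x).In)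

abbrev Port : Type := S.Source ⊕ S.Sink

/-- States of the whole controller: a state of each actor. -/
abbrev GState : Type := ∀ x, (S.actor x).mach.State

/-- The directed graph on ports given by the wires and by the pairs of an input port and an output
port of the same actor. -/
inductive Edge : S.Port → S.Port → Prop
  | wire (q : S.Sink) : Edge (Sum.inl (S.wire q)) (Sum.inr q)
  | actor (x : S.Act) (i : (S.actor x).In) (o : (S.actor x).Out) :
      Edge (Sum.inr (Sum.inr ⟨x, i⟩)) (Sum.inl (Sum.inr ⟨x, o⟩))

/-- There is no feedback loop: the graph on ports has no directed cycle. -/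
def NoFeedback : Prop := ∀ p : S.Port, ¬ Relation.TransGen S.Edge p p

/-- The relation of one evaluation cycle: on the external input `x`, starting in the states `s`, the
ports carry the values `p` and the actors move to the states `s'`; every wire copies its source to
its destination, and every actor executes its Mealy machine once. -/
structure Cycle (x : I → Bool) (s : S.GState) (p : S.Port → Sig) (s' : S.GState) : Prop where
  input : ∀ v, p (Sum.inl (Sum.inl v)) = some (x v)
  wires : ∀ q : S.Sink, p (Sum.inr q) = p (Sum.inl (S.wire q))
  outs : ∀ (a : S.Act) (o : (S.actor a).Out), p (Sum.inl (Sum.inr ⟨a, o⟩)) =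
    (S.actor a).mach.out (s a) (fun i => p (Sum.inr (Sum.inr ⟨a, i⟩))) o
  states : ∀ a : S.Act, s' a =
    (S.actor a).mach.next (s a) (fun i => p (Sum.inr (Sum.inr ⟨a, i⟩)))

/-- `s`, `p` are the states and port values of an infinite execution on the input sequence `a`. -/
structure IsRun (a : ℕ → I → Bool) (s : ℕ → S.GState) (p : ℕ → S.Port → Sig) : Prop where
  init : ∀ x, s 0 x = (S.actor x).mach.init
  cycle : ∀ t, S.Cycle (a t) (s t) (p t) (s (t + 1))

/-- The ω-word over `I ∪ O` that combines an input and an output sequence. -/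
def word (a : ℕ → I → Bool) (b : ℕ → O → Bool) : ℕ → I ⊕ O → Bool :=
  fun t => Sum.elim (a t) (b t)

/-- The controller realizes `f`: cycle-wise it acts as a deterministic Mealy machine (in each state,
each input assignment determines exactly one evaluation cycle), and on each input sequence `a` it
produces a sequence `b` of Boolean outputs such that the combined ω-word satisfies `f`. -/
structure Realizes (f : LTL (I ⊕ O)) : Prop where
  deterministic : ∀ (s : S.GState) (x : I → Bool),
    ∃! q : (S.Port → Sig) × S.GState, S.Cycle x s q.1 q.2
  correct : ∀ a : ℕ → I → Bool, ∃ s p, S.IsRun a s p ∧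
    ∃ b : ℕ → O → Bool, (∀ t v, p t (Sum.inr (Sum.inl v)) = some (b t v)) ∧
      LTL.Sat (word a b) f

end ActorSystem

/-! ### The actors used by the synthesis algorithm -/

section Actors

open scoped Classical

noncomputable section

/-- A memoryless actor with one output port. -/
def gate (P : Type) [hP : Finite P] (f : (P → Sig) → Sig) : Actor where
  In := P
  Out := Unit
  finiteIn := hP
  finiteOut := inferInstance
  mach :=
    { State := Unit
      finiteState := inferInstance
      init := ()
      out := fun _ i _ => f i
      next := fun _ _ => () }

/-- OR-gate on three-valued signals. -/
def orGate (P : Type) [Finite P] : Actor := gate P fun i =>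
  if ∃ x, i x = some true then some true else if ∃ x, i x = none then none else some false

/-- AND-gate on three-valued signals. -/
def andGate (P : Type) [Finite P] : Actor := gate P fun i =>
  if ∃ x, i x = some false then some false else if ∃ x, i x = none then none else some true

/-- Negation actor; "–" is passed on unchanged. -/
def notGate : Actor := gate Unit fun i => (i ()).map not

/-- The resolution actor with parameter `A`: `true` if some input is `true`, otherwise `false` if
some input is `false`, and `A` if all inputs are "–". -/
def resActor (P : Type) [Finite P] (A : Bool) : Actor := gate P fun i =>
  if ∃ x, i x = some true then some true else if ∃ x, i x = some false then some false else some A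

/-- If-then: the output is `true` when the input is `true`, and "–" otherwise. -/
def ifTB : Actor := gate Unit fun i => if i () = some true then some true else none

/-- Initial-until: the output is `true` as long as the input has not been `true`, and "–" from the
cycle on in which the input is `true` for the first time. The state records whether this has
happened. -/
def inUB : Actor where
  In := Unit
  Out := Unit
  finiteIn := inferInstance
  finiteOut := inferInstance
  mach :=
    { State := Bool
      finiteState := inferInstance
      init := false
      out := fun s i _ => if s = true ∨ i () = some true then none else some true
      next := fun s i => if s = true ∨ i () = some true then true else false }

/-- Input ports of the trigger-until actor. -/
inductive TrPort : Type
  | input | release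

instance : Finite TrPort :=
  Finite.of_surjective (fun b : Bool => if b then TrPort.input else TrPort.release)
    (by rintro (_ | _); exacts [⟨true, rfl⟩, ⟨false, rfl⟩])

/-- Trigger-until, with the state variable `lock`: when `release` is `true` the output is "–" and the
lock is opened; otherwise, when `input` is `true` or the lock is closed, the output is `true` and the
lock is closed; otherwise the output is "–". -/
def trUB : Actor where
  In := TrPort
  Out := Unit
  finiteIn := inferInstance
  finiteOut := inferInstance
  mach :=
    { State := Bool
      finiteState := inferInstance
      init := false
      out := fun lock i _ =>
        if i .release = some true then none
        else if lock = true ∨ i .input = some true then some true else none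
      next := fun lock i =>
        if i .release = some true then false
        else if lock = true ∨ i .input = some true then true else false }

/-- Input ports of the phase adjustment actor. -/
inductive ThPort : Type
  | set | input

instance : Finite ThPort :=
  Finite.of_surjective (fun b : Bool => if b then ThPort.set else ThPort.input)
    (by rintro (_ | _); exacts [⟨true, rfl⟩, ⟨false, rfl⟩])

/-- The phase adjustment actor for `h ≥ 1`: its output is `false` until `set` is `true` for the first
time; whenever `set` is `true`, its output is `false` in this cycle and the next `h - 1` cycles;
otherwise the output equals the port `input`. The state is `none` before `set` has been `true`, and
otherwise the number of cycles for which the output still has to be `false`. -/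
def thetaActor (h : ℕ) : Actor where
  In := ThPort
  Out := Unit
  finiteIn := inferInstance
  finiteOut := inferInstance
  mach :=
    { State := Option (Fin (h + 1))
      finiteState := inferInstance
      init := none
      out := fun s i _ =>
        if i .set = some true then some false
        else match s with
          | none => some false
          | some n => if n.val = 0 then i .input else some false
      next := fun s i =>
        if i .set = some true then some ⟨h - 1, by omega⟩
        else match s with
          | none => none
          | some n => some ⟨n.val - 1, by omega⟩ }

/-- Value of a signal `j` cycles ago, where `now` is the current value and `r` is the record of the
last `i` values (`none` stands for "not yet recorded"). -/
def past {i : ℕ} (r : Fin i → Sig) (now : Sig) : ℕ → Sig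
  | 0 => now
  | j + 1 => if h : j < i then r ⟨j, h⟩ else none

/-- Shift of the record of the last `i` values. -/
def shift {i : ℕ} (r : Fin i → Sig) (now : Sig) : Fin i → Sig := fun j => past r now j.val

/-- The variables that occur in a clause. -/
abbrev Clause.Vars {V : Type} (c : Clause V) : Type := {v : V // ∃ l ∈ c, l.var = v}

/-- All literals of the clause `c`, read with respect to the position `i` cycles ago, hold. -/
def monitorCond {V : Type} (c : Clause V) (i : ℕ) (r : c.Vars → Fin i → Sig)
    (now : c.Vars → Sig) : Prop :=
  ∀ (l : Lit V) (hl : l ∈ c),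
    past (r ⟨l.var, l, hl, rfl⟩) (now ⟨l.var, l, hl, rfl⟩) (i - l.depth) = some l.pos

/-- Monitor of a clause `c` with at most `i` next operators. Its state records the last `i` values of
each variable of `c` and of the constant `true` (so that it is known whether `i` cycles have passed).
In cycle `t ≥ i` the output tells whether `c` holds at position `t - i`. In the first `i` cycles the
output is `early`. -/
def monitor {V : Type} [Finite V] (c : Clause V) (i : ℕ) (early : Sig) : Actor where
  In := c.Vars
  Out := Unit
  finiteIn := inferInstance
  finiteOut := inferInstance
  mach :=
    { State := (c.Vars → Fin i → Sig) × (Fin i → Sig)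
      finiteState := inferInstance
      init := (fun _ _ => none, fun _ => none)
      out := fun s now _ =>
        if past s.2 (some true) i = some true then some (decide (monitorCond c i s.1 now)) else early
      next := fun s now => (fun v => shift (s.1 v) (now v), shift s.2 (some true)) }

end

end Actors

/-! ### The generated controller -/

section Synthesis

variable {I O : Type}

/-- The negation of the output variable `v` occurs in the "release" part of some specification. -/
def Spec.NegRelease (φ : Spec I O) (v : O) : Prop :=
  ∃ m, ∃ c ∈ (φ.η m).relOutClauses, ∃ l ∈ c, l.var = v ∧ l.pos = false

/-- The actors of the generated controller; `m` is the index of a specification and `c` the index of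
a clause. -/
inductive Node (φ : Spec I O) : Type
  /-- resolution actor of an output variable -/
  | res (v : O)
  /-- negation of the output of a resolution actor -/
  | notRes (v : O) (h : φ.NegRelease v)
  /-- high-level controllers for P1, P2, P3 -/
  | inUB (m : Fin φ.k) (h : (φ.η m).kind = .p1)
  | trUB (m : Fin φ.k) (h : (φ.η m).kind = .p2)
  | ifTB (m : Fin φ.k) (h : (φ.η m).kind = .p3)
  /-- negation of what the `m`-th specification demands, if its output literal is negative -/
  | negOut (m : Fin φ.k) (v : O) (h : (φ.η m).target = some ⟨v, false⟩)
  /-- OR-gate and monitors of the "input" part -/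
  | orIn (m : Fin φ.k) (h : (φ.η m).kind ≠ .p5)
  | monIn (m : Fin φ.k) (c : Fin (φ.η m).inClauses.length)
  /-- OR-gate, monitors, phase adjustment and AND-gates of the "release" part -/
  | orRel (m : Fin φ.k) (h : (φ.η m).kind = .p2)
  | monRel (m : Fin φ.k) (c : Fin (φ.η m).relInClauses.length)
  | theta (m : Fin φ.k) (c : Fin (φ.η m).relInClauses.length)
      (h : ((φ.η m).relInClauses.get c).depth ≠ 0)
  | andRel (m : Fin φ.k) (c : Fin (φ.η m).relOutClauses.length)

theorem Node.finite [Finite O] (φ : Spec I O) : Finite (Node φ) := by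
  let T := (O ⊕ O) ⊕ (Fin φ.k × Fin 5) ⊕ (Fin φ.k × O) ⊕
    ((Σ m, Fin (φ.η m).inClauses.length) ⊕ (Σ m, Fin (φ.η m).relInClauses.length) ⊕
      (Σ m, Fin (φ.η m).relInClauses.length) ⊕ (Σ m, Fin (φ.η m).relOutClauses.length))
  let f : Node φ → T := fun n => match n with
    | .res v => .inl (.inl v)
    | .notRes v _ => .inl (.inr v)
    | .inUB m _ => .inr (.inl (m, 0))
    | .trUB m _ => .inr (.inl (m, 1))
    | .ifTB m _ => .inr (.inl (m, 2))
    | .orIn m _ => .inr (.inl (m, 3))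
    | .orRel m _ => .inr (.inl (m, 4))
    | .negOut m v _ => .inr (.inr (.inl (m, v)))
    | .monIn m c => .inr (.inr (.inr (.inl ⟨m, c⟩)))
    | .monRel m c => .inr (.inr (.inr (.inr (.inl ⟨m, c⟩))))
    | .theta m c _ => .inr (.inr (.inr (.inr (.inr (.inl ⟨m, c⟩)))))
    | .andRel m c => .inr (.inr (.inr (.inr (.inr (.inr ⟨m, c⟩)))))
  refine Finite.of_injective f ?_
  intro a b hab
  cases a <;> cases b <;> simp [f] at hab <;> try (obtain ⟨rfl, hab⟩ := hab) <;> simp_all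

/-- Input ports of the resolution actor of `v`: the specifications whose output literal is on `v`. -/
abbrev Spec.Demands (φ : Spec I O) (v : O) : Type :=
  {m : Fin φ.k // ∃ b, (φ.η m).target = some ⟨v, b⟩}

open scoped Classical in
/-- The actor at each node, where `A v` is the parameter of the resolution actor of `v`. The monitors
for P4 yield "–" before the clause can be evaluated, and all other monitors yield `false`. -/
noncomputable def Node.toActor [Finite I] {φ : Spec I O} (A : O → Bool) : Node φ → Actor
  | .res v => resActor (φ.Demands v) (A v)
  | .notRes _ _ => notGate
  | .inUB _ _ => GXW.inUB
  | .trUB _ _ => GXW.trUB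
  | .ifTB _ _ => GXW.ifTB
  | .negOut _ _ _ => notGate
  | .orIn m _ => orGate (Fin (φ.η m).inClauses.length)
  | .monIn m c => monitor ((φ.η m).inClauses.get c)
      ((φ.η m).inLevel ((φ.η m).inClauses.get c))
      (if (φ.η m).kind = .p4 then none else some false)
  | .orRel m _ => orGate (Fin (φ.η m).relInClauses.length ⊕ Fin (φ.η m).relOutClauses.length)
  | .monRel m c => monitor ((φ.η m).relInClauses.get c)
      ((φ.η m).relInClauses.get c).depth (some false)
  | .theta m c _ => thetaActor ((φ.η m).relInClauses.get c).depth
  | .andRel m c => andGate (Fin ((φ.η m).relOutClauses.get c).length)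

theorem Pattern.kind_ne_of_target {p : Pattern I O} {l : OutLit O} (h : p.target = some l) :
    p.kind ≠ .p5 := by
  cases p <;> simp_all [Pattern.target, Pattern.kind]

theorem Pattern.kind_ne_of_relIn {p : Pattern I O} (c : Fin p.relInClauses.length) :
    p.kind ≠ .p5 := by
  cases p <;> simp [Pattern.kind]
  exact c.elim0

theorem Kind.p2_ne {κ : Kind} (h : κ = .p2) : κ ≠ .p5 := by subst h; simp

theorem Kind.p1_ne {κ : Kind} (h : κ = .p1) : κ ≠ .p5 := by subst h; simp

theorem Kind.p3_ne {κ : Kind} (h : κ = .p3) : κ ≠ .p5 := by subst h; simp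

/-- The actor whose output represents the demand of the `m`-th specification on its output literal:
the high-level controller for P1, P2, P3, and the OR-gate of the monitors for P4. -/
def Node.control (φ : Spec I O) (m : Fin φ.k) (h : (φ.η m).kind ≠ .p5) : Node φ :=
  match hk : (φ.η m).kind with
  | .p1 => .inUB m hk
  | .p2 => .trUB m hk
  | .p3 => .ifTB m hk
  | .p4 => .orIn m h
  | .p5 => absurd hk h

/-- The place from which a wire starts: an external input port or the output port of an actor. -/
abbrev Origin (φ : Spec I O) : Type := I ⊕ Node φ

open scoped Classical in
/-- The wire that ends in a given input port of a given actor. -/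
noncomputable def Node.origin [Finite I] {φ : Spec I O} (A : O → Bool) :
    (n : Node φ) → (n.toActor A).In → Origin φ
  | .res v, (m : φ.Demands v) =>
      if h : (φ.η m.1).target = some ⟨v, false⟩ then .inr (.negOut m.1 v h)
      else .inr (Node.control φ m.1 (Pattern.kind_ne_of_target m.2.choose_spec))
  | .notRes v _, _ => .inr (.res v)
  | .inUB m h, _ => .inr (.orIn m (Kind.p1_ne h))
  | .trUB m h, (i : TrPort) => match i with
      | .input => .inr (.orIn m (Kind.p2_ne h))
      | .release => .inr (.orRel m h)
  | .ifTB m h, _ => .inr (.orIn m (Kind.p3_ne h))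
  | .negOut m _ h, _ => .inr (Node.control φ m (Pattern.kind_ne_of_target h))
  | .orIn m _, (c : Fin (φ.η m).inClauses.length) => .inr (.monIn m c)
  | .monIn m c, (v : ((φ.η m).inClauses.get c).Vars) => .inl v.1
  | .orRel m _, (i : Fin (φ.η m).relInClauses.length ⊕ Fin (φ.η m).relOutClauses.length) =>
      match i with
      | .inl c => if h : ((φ.η m).relInClauses.get c).depth ≠ 0 then .inr (.theta m c h)
          else .inr (.monRel m c)
      | .inr c => .inr (.andRel m c)
  | .monRel m c, (v : ((φ.η m).relInClauses.get c).Vars) => .inl v.1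
  | .theta m c _, (i : ThPort) => match i with
      | .set => .inr (.orIn m (Pattern.kind_ne_of_relIn c))
      | .input => .inr (.monRel m c)
  | .andRel m c, (i : Fin ((φ.η m).relOutClauses.get c).length) =>
      if h : (((φ.η m).relOutClauses.get c).get i).pos = false then
        .inr (.notRes (((φ.η m).relOutClauses.get c).get i).var
          ⟨m, _, List.get_mem _ _, _, List.get_mem _ _, rfl, h⟩)
      else .inr (.res (((φ.η m).relOutClauses.get c).get i).var)

/-- Each actor of the controller has exactly one output port. -/
def Node.outPort [Finite I] {φ : Spec I O} (A : O → Bool) (n : Node φ) : (n.toActor A).Out :=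
  match n with
  | .res _ | .notRes _ _ | .inUB _ _ | .trUB _ _ | .ifTB _ _ | .negOut _ _ _ | .orIn _ _
  | .monIn _ _ | .orRel _ _ | .monRel _ _ | .theta _ _ _ | .andRel _ _ => ()

/-- The controller constructed from `φ`, with the values `A` for the parameters of the resolution
actors. -/
noncomputable def controller [Finite I] [Finite O] (φ : Spec I O) (A : O → Bool) :
    ActorSystem I O where
  Act := Node φ
  finiteAct := Node.finite φ
  actor := Node.toActor A
  wire
    | .inl v => .inr ⟨.res v, Node.outPort A (.res v)⟩
    | .inr ⟨n, i⟩ => match Node.origin A n i with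
      | .inl v => .inl v
      | .inr n' => .inr ⟨n', Node.outPort A n'⟩

/-- The port value at the `m`-th input port of the resolution actor of `v`. -/
def resInput [Finite I] [Finite O] (φ : Spec I O) (A : O → Bool)
    (p : (controller φ A).Port → Sig) (v : O) (m : φ.Demands v) : Sig :=
  p (Sum.inr (Sum.inr ⟨Node.res v, m⟩))

/-- `A` is a witness for the existential variables of the 2QBF formula `∃ A, ∀ …, Υa → Υg`. The
universal variables are the external inputs `x`, all port values `p` and all state variables, before
(`s`, not only reachable ones) and after (`s'`) the cycle. `Υa`: the assumption of `φ` holds, and `p`,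
`s`, `s'` obey the wires and the transition relations. `Υg`: no resolution actor receives both `true`
and `false`, and the outputs `y` satisfy all invariants of type P5. -/
def QBFWitness [Finite I] [Finite O] (φ : Spec I O) (A : O → Bool) : Prop :=
  ∀ (x : I → Bool) (s s' : (controller φ A).GState) (p : (controller φ A).Port → Sig)
    (y : O → Bool),
    φ.assumption.Holds x → (controller φ A).Cycle x s p s' →
    (∀ v, p (Sum.inr (Sum.inl v)) = some (y v)) →
    (∀ v, ¬ ∃ i j : φ.Demands v,
      resInput φ A p v i = some true ∧ resInput φ A p v j = some false) ∧
    (∀ m d, φ.η m = Pattern.P5 d → d.Holds y)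

/-- `S` is returned by the synthesis algorithm on `φ`: it is the constructed controller, it has no
feedback loop, and its parameters are a witness of the 2QBF check. -/
def Generated [Finite I] [Finite O] (φ : Spec I O) (S : ActorSystem I O) : Prop :=
  ∃ A : O → Bool, S = controller φ A ∧ S.NoFeedback ∧ QBFWitness φ A

end Synthesis

end GXW

/-!
The first half of the claim concerns arbitrary actor systems. The port graph is finite, so without
a feedback loop it is well-founded, and the values of the ports in a cycle are determined by recursion
along its edges (`ActorSystem.cycle_portValue`, `ActorSystem.Cycle.eq_of_wellFounded`). Iterating
the cycles yields a run on every input sequence. A resolution actor never outputs "–", hence the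
external outputs are Boolean.

For the second half, fix a run on which the assumption of the specification holds at all positions.
Every cycle of this run is then an instance of the 2QBF formula, because that formula quantifies over
all states. Thus every invariant of type P5 holds in each cycle, and no resolution actor receives
contradictory demands, so each output variable follows every demand other than "–" that is
made on it (`Controller.output_of_control`). It remains to see that the demands suffice.
A monitor of level `h` reports in cycle `t ≥ h` whether its clause held at position `t - h`
(`monitor_out`), which settles P3 and P4. For P1 and P2, weak until is treated as a safety property:
it is enough that the demand is made in every cycle that no releasing position precedes
(`LTL.satAt_W_of_forall`). A report of a monitor concerns the present or an earlier position,
so the initial-until actor never gives up its demand too early. In the case of P2, a report could in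
addition concern a position before the trigger; the phase adjustment actors suppress exactly
these reports (`thetaActor_out_eq_false`, `Controller.exists_holdsAt_of_release`).
-/

namespace GXW

/-! ### Semantics of the formulae in a specification -/

namespace LTL

variable {α : Type} {σ : ℕ → α → Bool}

theorem satAt_XN (i : ℕ) (f : LTL α) (t : ℕ) : SatAt σ (XN i f) t ↔ SatAt σ f (t + i) := by
  induction i generalizing t with
  | zero => rfl
  | succ i ih =>
    rw [show t + (i + 1) = t + 1 + i by omega]
    exact ih (t + 1)

theorem satAt_conj (l : List (LTL α)) (t : ℕ) : SatAt σ (conj l) t ↔ ∀ f ∈ l, SatAt σ f t := by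
  induction l with
  | nil => simp [conj, SatAt]
  | cons f l ih =>
    rw [List.forall_mem_cons, ← ih]
    rfl

theorem satAt_disj (l : List (LTL α)) (t : ℕ) : SatAt σ (disj l) t ↔ ∃ f ∈ l, SatAt σ f t := by
  induction l with
  | nil => simp [disj, SatAt]
  | cons f l ih =>
    rw [List.exists_mem_cons_iff, ← ih]
    rfl

/-- Weak until as a safety property: at every position `f` holds unless `g` has already held. -/
theorem satAt_W_of_forall {f g : LTL α} {t : ℕ}
    (h : ∀ s, t ≤ s → (∀ r, t ≤ r → r ≤ s → ¬ SatAt σ g r) → SatAt σ f s) :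
    SatAt σ (W f g) t := by
  classical
  by_cases hg : ∃ s, t ≤ s ∧ SatAt σ g s
  · obtain ⟨hts, hs⟩ := Nat.find_spec hg
    refine Or.inl ⟨Nat.find hg, hts, hs, fun r hr hrs => h r hr fun q hq hqr hgq => ?_⟩
    exact Nat.find_min hg (lt_of_le_of_lt hqr hrs) ⟨hq, hgq⟩
  · exact Or.inr fun s hs => h s hs fun r hr _ hgr => hg ⟨r, hr, hgr⟩

end LTL

/-- The clause `c` holds at position `t` of the sequence `a` of assignments. -/
def Clause.HoldsAt {V : Type} (a : ℕ → V → Bool) (c : Clause V) (t : ℕ) : Prop :=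
  ∀ l ∈ c, a (t + l.depth) l.var = l.pos

section Semantics

variable {V α : Type} {σ : ℕ → α → Bool}

theorem Lit.satAt_toLTL (e : V → α) (l : Lit V) (t : ℕ) :
    LTL.SatAt σ (l.toLTL e) t ↔ σ (t + l.depth) (e l.var) = l.pos := by
  obtain ⟨d, v, _ | _⟩ := l <;> simp [Lit.toLTL, LTL.SatAt, LTL.satAt_XN]

theorem Clause.satAt_toLTL (e : V → α) (c : Clause V) (t : ℕ) :
    LTL.SatAt σ (c.toLTL e) t ↔ c.HoldsAt (fun t v => σ t (e v)) t := by
  simp [Clause.toLTL, LTL.satAt_conj, Lit.satAt_toLTL, Clause.HoldsAt]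

theorem DNF.satAt_toLTL {i : ℕ} (e : V → α) (d : DNF V i) (t : ℕ) :
    LTL.SatAt σ (d.toLTL e) t ↔ ∃ c ∈ d.clauses, Clause.HoldsAt (fun t v => σ t (e v)) c t := by
  simp [DNF.toLTL, LTL.satAt_disj, Clause.satAt_toLTL]

theorem DNF.satAt_toLTL_zero (e : V → α) (d : DNF V 0) (t : ℕ) :
    LTL.SatAt σ (d.toLTL e) t ↔ d.Holds (fun v => σ t (e v)) := by
  rw [DNF.satAt_toLTL]
  refine exists_congr fun c => and_congr_right fun hc => forall₂_congr fun l hl => ?_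
  simp [Nat.le_zero.mp (d.bound c hc l hl)]

theorem OutLit.satAt_toLTL (e : V → α) (l : OutLit V) (t : ℕ) :
    LTL.SatAt σ (l.toLTL e) t ↔ σ t (e l.var) = l.pos := by
  obtain ⟨v, _ | _⟩ := l <;> simp [OutLit.toLTL, LTL.SatAt]

theorem Lit.depth_le_clause {c : Clause V} {l : Lit V} (hl : l ∈ c) : l.depth ≤ c.depth := by
  induction c with
  | nil => simp at hl
  | cons k c ih =>
    simp only [Clause.depth, List.map_cons, List.foldr_cons] at ih ⊢
    rcases List.mem_cons.mp hl with rfl | hl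
    · exact le_max_left _ _
    · exact (ih hl).trans (le_max_right _ _)

end Semantics

theorem Pattern.depth_le_inLevel {I O : Type} (p : Pattern I O) {c : Clause I}
    (hc : c ∈ p.inClauses) {l : Lit I} (hl : l ∈ c) : l.depth ≤ p.inLevel c := by
  cases p with
  | P1 out inp => exact Lit.depth_le_clause hl
  | P2 inp => exact inp.bound c hc l hl
  | P3 inp => exact inp.bound c hc l hl
  | P4 inp => exact inp.bound c hc l hl
  | P5 => simp [Pattern.inClauses] at hc

/-! ### Executions of systems without feedback loops -/

namespace ActorSystem

variable {I O : Type} (S : ActorSystem I O)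

theorem finite_port [Finite I] [Finite O] : Finite S.Port := by
  have := S.finiteAct
  have := fun x => (S.actor x).finiteIn
  have := fun x => (S.actor x).finiteOut
  infer_instance

variable {S}

theorem NoFeedback.wellFounded [Finite I] [Finite O] (h : S.NoFeedback) : WellFounded S.Edge := by
  have := S.finite_port
  have : Std.Irrefl (Relation.TransGen S.Edge) := ⟨h⟩
  have : IsTrans S.Port (Relation.TransGen S.Edge) := ⟨fun _ _ _ => Relation.TransGen.trans⟩
  exact Subrelation.wf (fun h => Relation.TransGen.single h)
    (Finite.wellFounded_of_trans_of_irrefl (Relation.TransGen S.Edge))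

/-- The values of the ports in one cycle, computed by recursion along the edges of the port graph. -/
noncomputable def portValue (hwf : WellFounded S.Edge) (x : I → Bool) (s : S.GState) :
    S.Port → Sig :=
  hwf.fix fun q ih => match q, ih with
    | Sum.inl (Sum.inl v), _ => some (x v)
    | Sum.inl (Sum.inr ⟨a, o⟩), ih => (S.actor a).mach.out (s a)
        (fun i => ih (Sum.inr (Sum.inr ⟨a, i⟩)) (Edge.actor a i o)) o
    | Sum.inr q, ih => ih (Sum.inl (S.wire q)) (Edge.wire q)

theorem cycle_portValue (hwf : WellFounded S.Edge) (x : I → Bool) (s : S.GState) :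
    S.Cycle x s (portValue hwf x s) (fun a => (S.actor a).mach.next (s a)
      (fun i => portValue hwf x s (Sum.inr (Sum.inr ⟨a, i⟩)))) where
  input v := by rw [portValue, hwf.fix_eq]
  wires q := by rw [portValue, hwf.fix_eq]
  outs a o := by rw [portValue, hwf.fix_eq]
  states a := rfl

theorem Cycle.eq_of_wellFounded (hwf : WellFounded S.Edge) {x : I → Bool} {s s₁ s₂ : S.GState}
    {p₁ p₂ : S.Port → Sig} (h₁ : S.Cycle x s p₁ s₁) (h₂ : S.Cycle x s p₂ s₂) :
    p₁ = p₂ ∧ s₁ = s₂ := by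
  have hp : p₁ = p₂ := by
    funext q
    induction q using hwf.induction with
    | _ q ih =>
      match q, ih with
      | Sum.inl (Sum.inl v), _ => rw [h₁.input, h₂.input]
      | Sum.inl (Sum.inr ⟨a, o⟩), ih =>
        rw [h₁.outs, h₂.outs]
        congr 1
        exact funext fun i => ih _ (Edge.actor a i o)
      | Sum.inr q, ih => rw [h₁.wires, h₂.wires, ih _ (Edge.wire q)]
  subst hp
  exact ⟨rfl, funext fun a => (h₁.states a).trans (h₂.states a).symm⟩

theorem exists_isRun (h : ∀ (s : S.GState) (x : I → Bool), ∃ p s', S.Cycle x s p s')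
    (a : ℕ → I → Bool) : ∃ s p, S.IsRun a s p := by
  choose p s' hc using h
  exact ⟨fun t => Nat.rec (fun x => (S.actor x).mach.init) (fun t s => s' s (a t)) t,
    fun t => p _ (a t), fun _ => rfl, fun t => hc _ _⟩

end ActorSystem

/-! ### Behaviour of the individual actors -/

section Actors

theorem orGate_out_eq_true {P : Type} [Finite P] (u) (i : P → Sig) (o) :
    (orGate P).mach.out u i o = some true ↔ ∃ x, i x = some true := by
  simp only [orGate, gate]
  split_ifs <;> simp_all

theorem orGate_out_ne_none {P : Type} [Finite P] (u) (i : P → Sig) (o) (h : ∀ x, i x ≠ none) :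
    (orGate P).mach.out u i o ≠ none := by
  simp only [orGate, gate]
  split_ifs <;> simp_all

theorem andGate_out_eq_true {P : Type} [Finite P] (u) (i : P → Sig) (o) :
    (andGate P).mach.out u i o = some true ↔ ∀ x, i x = some true := by
  simp only [andGate, gate]
  split_ifs with h₁ h₂
  · obtain ⟨x, hx⟩ := h₁
    simpa using ⟨x, by simp [hx]⟩
  · obtain ⟨x, hx⟩ := h₂
    simpa using ⟨x, by simp [hx]⟩
  · simp only [true_iff]
    intro x
    rcases hx : i x with _ | _ | _
    · exact absurd ⟨x, hx⟩ h₂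
    · exact absurd ⟨x, hx⟩ h₁
    · rfl

theorem resActor_out_ne_none {P : Type} [Finite P] (A : Bool) (u) (i : P → Sig) (o) :
    (resActor P A).mach.out u i o ≠ none := by
  simp only [resActor, gate]
  split_ifs <;> simp

/-- Without contradictory inputs, the resolution actor obeys each input that is not "–". -/
theorem resActor_out_of_input {P : Type} [Finite P] (A : Bool) (u) (i : P → Sig) (o)
    (h : ¬ ∃ x y, i x = some true ∧ i y = some false) {x : P} {b : Bool} (hx : i x = some b) :
    (resActor P A).mach.out u i o = some b := by
  simp only [resActor, gate]
  cases b with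
  | true => rw [if_pos ⟨x, hx⟩]
  | false => rw [if_neg fun ⟨y, hy⟩ => h ⟨y, x, hy, hx⟩, if_pos ⟨x, hx⟩]

/-- The initial-until actor outputs `true` as long as its input has not been `true`. -/
theorem inUB_out_eq_true {s : ℕ → inUB.mach.State} {i : ℕ → inUB.In → Sig}
    (h0 : s 0 = inUB.mach.init) (hs : ∀ t, s (t + 1) = inUB.mach.next (s t) (i t)) (t : ℕ)
    (hi : ∀ r ≤ t, i r () ≠ some true) (o) : inUB.mach.out (s t) (i t) o = some true := by
  have key : ∀ r ≤ t, s r = false := by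
    intro r
    induction r with
    | zero => exact fun _ => h0
    | succ r ih =>
      intro hr
      rw [hs r]
      have := ih (by omega)
      have := hi r (by omega)
      simp_all [inUB]
  have := key t le_rfl
  have := hi t le_rfl
  simp_all [inUB]

/-- Once triggered, the trigger-until actor outputs `true` as long as it is not released. -/
theorem trUB_out_eq_true {s : ℕ → trUB.mach.State} {i : ℕ → trUB.In → Sig}
    (hs : ∀ t, s (t + 1) = trUB.mach.next (s t) (i t)) {u t : ℕ} (hut : u ≤ t)
    (hu : i u TrPort.input = some true)
    (hi : ∀ r, u ≤ r → r ≤ t → i r TrPort.release ≠ some true) (o) :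
    trUB.mach.out (s t) (i t) o = some true := by
  -- From the trigger on, the lock is closed, except possibly in the cycle of the trigger itself.
  have key : ∀ r, u ≤ r → r ≤ t → s r = true ∨ i r TrPort.input = some true := by
    intro r hr
    induction r, hr using Nat.le_induction with
    | base => exact fun _ => Or.inr hu
    | succ r hr ih =>
      intro hrt
      refine Or.inl ((hs r).trans ?_)
      have := ih (by omega)
      have := hi r hr (by omega)
      simp_all [trUB]
  have := key t hut le_rfl
  have := hi t hut le_rfl
  simp_all [trUB]

/-- The phase adjustment actor blocks its input in the `h` cycles that start with a set. -/
theorem thetaActor_out_eq_false {h : ℕ} {s : ℕ → (thetaActor h).mach.State}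
    {i : ℕ → (thetaActor h).In → Sig}
    (hs : ∀ t, s (t + 1) = (thetaActor h).mach.next (s t) (i t)) {u t : ℕ} (hut : u ≤ t)
    (hth : t < u + h) (hu : i u ThPort.set = some true) (o) :
    (thetaActor h).mach.out (s t) (i t) o = some false := by
  -- `k + 1` cycles after a set, at least `h - 1 - k` cycles still have to be blocked.
  have key : ∀ k, ∃ n : Fin (h + 1), s (u + k + 1) = some n ∧ h ≤ n.val + k + 1 := by
    intro k
    induction k with
    | zero =>
      refine ⟨⟨h - 1, by omega⟩, ?_, by simp only; omega⟩
      rw [hs]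
      simp [thetaActor, hu]
    | succ k ih =>
      obtain ⟨n, hn, hle⟩ := ih
      have hs' := hs (u + k + 1)
      rw [hn] at hs'
      by_cases hi : i (u + k + 1) ThPort.set = some true
      · refine ⟨⟨h - 1, by omega⟩, ?_, by simp only; omega⟩
        refine hs'.trans ?_
        simp [thetaActor, hi]
      · refine ⟨⟨n.val - 1, by omega⟩, ?_, by simp only; omega⟩
        refine hs'.trans ?_
        simp [thetaActor, hi]
  -- In the cycle of the set itself, the output is `false` irrespective of the state.
  rcases Nat.eq_or_lt_of_le hut with rfl | hlt
  · simp [thetaActor, hu]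
  · obtain ⟨n, hn, hle⟩ := key (t - u - 1)
    rw [show u + (t - u - 1) + 1 = t by omega] at hn
    have hn0 : n.val ≠ 0 := by omega
    rw [hn]
    simp [thetaActor, hn0]

theorem thetaActor_input_eq_true {h : ℕ} (s : (thetaActor h).mach.State)
    (i : (thetaActor h).In → Sig) (o) (ho : (thetaActor h).mach.out s i o = some true) :
    i ThPort.input = some true := by
  simp only [thetaActor] at ho
  split_ifs at ho
  · simp at ho
  · split at ho
    · simp at ho
    · split_ifs at ho
      · exact ho
      · simp at ho

/-- The record kept by a monitor contains the values of the last `i` cycles. -/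
theorem past_record {i : ℕ} {r : ℕ → Fin i → Sig} {f : ℕ → Sig} (h0 : r 0 = fun _ => none)
    (hr : ∀ t, r (t + 1) = shift (r t) (f t)) (t j : ℕ) (hj : j ≤ i) :
    past (r t) (f t) j = if j ≤ t then f (t - j) else none := by
  induction t generalizing j with
  | zero => cases j <;> simp [past, h0]
  | succ t ih =>
    cases j with
    | zero => simp [past]
    | succ j =>
      have hj' : j < i := hj
      rw [show past (r (t + 1)) (f (t + 1)) (j + 1) = past (r t) (f t) j from
        (dif_pos hj').trans (congrFun (hr t) ⟨j, hj'⟩), ih j hj'.le]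
      simp

/-- From cycle `i` on, a monitor of level `i` reports whether its clause held `i` cycles earlier;
before that, it yields its default output. -/
theorem monitor_out {V : Type} [Finite V] {c : Clause V} {i : ℕ} {early : Sig}
    (hci : ∀ l ∈ c, l.depth ≤ i) {s : ℕ → (monitor c i early).mach.State} {a : ℕ → V → Bool}
    (h0 : s 0 = (monitor c i early).mach.init)
    (hs : ∀ t, s (t + 1) = (monitor c i early).mach.next (s t)
      (fun v : c.Vars => some (a t v.1))) (t : ℕ) (o) [Decidable (c.HoldsAt a (t - i))] :
    (monitor c i early).mach.out (s t) (fun v : c.Vars => some (a t v.1)) o =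
      if i ≤ t then some (decide (c.HoldsAt a (t - i))) else early := by
  have hclock : past (s t).2 (some true) i = if i ≤ t then some true else none :=
    past_record (r := fun t => (s t).2) (f := fun _ => some true) (by simp [h0, monitor])
      (fun t => by simp [hs t, monitor]) t i le_rfl
  have hvar : ∀ (v : c.Vars) (j : ℕ), j ≤ i → past ((s t).1 v) (some (a t v.1)) j =
      if j ≤ t then some (a (t - j) v.1) else none := fun v j hj =>
    past_record (r := fun t => (s t).1 v) (f := fun t => some (a t v.1)) (by simp [h0, monitor])
      (fun t => by simp [hs t, monitor]) t j hj
  have hout : (monitor c i early).mach.out (s t) (fun v : c.Vars => some (a t v.1)) o =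
      if past (s t).2 (some true) i = some true then
        some (@decide (monitorCond c i (s t).1 fun v => some (a t v.1))
          (Classical.propDecidable _))
      else early := rfl
  rw [hout, hclock]
  by_cases hit : i ≤ t
  · have hcond : monitorCond c i (s t).1 (fun v => some (a t v.1)) ↔ c.HoldsAt a (t - i) := by
      refine forall₂_congr fun l hl => ?_
      have hli := hci l hl
      rw [hvar _ _ (Nat.sub_le _ _), if_pos (by omega),
        show t - (i - l.depth) = t - i + l.depth by omega]
      simp
    simp [hit, hcond]
  · simp [hit]

end Actors

/-! ### Behaviour of the generated controller in one cycle -/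

theorem Node.control_p1 {I O : Type} {φ : Spec I O} {m : Fin φ.k} (hk : (φ.η m).kind = .p1) (h) :
    Node.control φ m h = .inUB m hk := by
  unfold Node.control
  split <;> rename_i h' <;> first | rfl | exact nomatch hk.symm.trans h'

theorem Node.control_p2 {I O : Type} {φ : Spec I O} {m : Fin φ.k} (hk : (φ.η m).kind = .p2) (h) :
    Node.control φ m h = .trUB m hk := by
  unfold Node.control
  split <;> rename_i h' <;> first | rfl | exact nomatch hk.symm.trans h'

theorem Node.control_p3 {I O : Type} {φ : Spec I O} {m : Fin φ.k} (hk : (φ.η m).kind = .p3) (h) :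
    Node.control φ m h = .ifTB m hk := by
  unfold Node.control
  split <;> rename_i h' <;> first | rfl | exact nomatch hk.symm.trans h'

theorem Node.control_p4 {I O : Type} {φ : Spec I O} {m : Fin φ.k} (hk : (φ.η m).kind = .p4) (h) :
    Node.control φ m h = .orIn m h := by
  unfold Node.control
  split <;> rename_i h' <;> first | rfl | exact nomatch hk.symm.trans h'

namespace Controller

variable {I O : Type} [Finite I] [Finite O] {φ : Spec I O} {A : O → Bool}

/-- The value at the output port of a node. -/
def nodeValue (p : (controller φ A).Port → Sig) (n : Node φ) : Sig :=
  p (Sum.inl (Sum.inr ⟨n, Node.outPort A n⟩))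

/-- The value carried by the wires that start at a given origin, for the external input `x`. -/
def originValue (x : I → Bool) (p : (controller φ A).Port → Sig) : Origin φ → Sig
  | .inl v => some (x v)
  | .inr n => nodeValue p n

section Cycle

variable {x : I → Bool} {s s' : (controller φ A).GState} {p : (controller φ A).Port → Sig}

theorem input_eq (hc : (controller φ A).Cycle x s p s') (n : Node φ) (i : (n.toActor A).In) :
    p (Sum.inr (Sum.inr ⟨n, i⟩)) = originValue x p (Node.origin A n i) := by
  have hw : (controller φ A).wire (Sum.inr ⟨n, i⟩) = match Node.origin A n i with
      | .inl v => Sum.inl v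
      | .inr n' => Sum.inr ⟨n', Node.outPort A n'⟩ := rfl
  rw [hc.wires, hw]
  cases Node.origin A n i with
  | inl v => exact hc.input v
  | inr n' => rfl

theorem nodeValue_eq (hc : (controller φ A).Cycle x s p s') (n : Node φ) :
    nodeValue p n = (n.toActor A).mach.out (s n)
      (fun i => originValue x p (Node.origin A n i)) (Node.outPort A n) := by
  rw [← funext (input_eq hc n)]
  exact hc.outs n (Node.outPort A n)

theorem next_eq (hc : (controller φ A).Cycle x s p s') (n : Node φ) :
    s' n = (n.toActor A).mach.next (s n) (fun i => originValue x p (Node.origin A n i)) := by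
  rw [← funext (input_eq hc n)]
  exact hc.states n

theorem output_eq (hc : (controller φ A).Cycle x s p s') (v : O) :
    p (Sum.inr (Sum.inl v)) = nodeValue p (.res v) :=
  hc.wires (Sum.inl v)

theorem res_ne_none (hc : (controller φ A).Cycle x s p s') (v : O) :
    nodeValue p (.res v) ≠ none := by
  rw [nodeValue_eq hc]
  exact resActor_out_ne_none _ _ _ _

theorem notRes_eq (hc : (controller φ A).Cycle x s p s') (v : O) (h : φ.NegRelease v) :
    nodeValue p (.notRes v h) = (nodeValue p (.res v)).map not :=
  nodeValue_eq hc (.notRes v h)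

theorem negOut_eq (hc : (controller φ A).Cycle x s p s') (m : Fin φ.k) (v : O)
    (h : (φ.η m).target = some ⟨v, false⟩) : nodeValue p (.negOut m v h) =
      (nodeValue p (Node.control φ m (Pattern.kind_ne_of_target h))).map not :=
  nodeValue_eq hc (.negOut m v h)

theorem orIn_eq_true (hc : (controller φ A).Cycle x s p s') (m : Fin φ.k)
    (h : (φ.η m).kind ≠ .p5) : nodeValue p (.orIn m h) = some true ↔
      ∃ c, nodeValue p (.monIn m c) = some true := by
  rw [nodeValue_eq hc]
  exact orGate_out_eq_true _ _ _

theorem orIn_ne_none (hc : (controller φ A).Cycle x s p s') (m : Fin φ.k)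
    (h : (φ.η m).kind ≠ .p5) (hm : ∀ c, nodeValue p (.monIn m c) ≠ none) :
    nodeValue p (.orIn m h) ≠ none := by
  rw [nodeValue_eq hc]
  exact orGate_out_ne_none _ _ _ hm

/-- An AND-gate of the release part is `true` only if its clause holds for the outputs `y`. -/
theorem holds_of_andRel (hc : (controller φ A).Cycle x s p s') {y : O → Bool}
    (hy : ∀ v, p (Sum.inr (Sum.inl v)) = some (y v)) (m : Fin φ.k)
    (c : Fin (φ.η m).relOutClauses.length) (h : nodeValue p (.andRel m c) = some true) :
    ∀ l ∈ (φ.η m).relOutClauses.get c, y l.var = l.pos := by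
  rw [nodeValue_eq hc] at h
  intro l hl
  obtain ⟨i, rfl⟩ := List.mem_iff_get.mp hl
  have hi := (andGate_out_eq_true _ _ _).mp h i
  have hr := (output_eq hc (((φ.η m).relOutClauses.get c).get i).var).symm.trans (hy _)
  by_cases hp : (((φ.η m).relOutClauses.get c).get i).pos = false
  · have ho : Node.origin A (.andRel m c) i = .inr (.notRes _ _) := dif_pos hp
    rw [ho] at hi
    have := (notRes_eq hc _ _).symm.trans hi
    rw [hr] at this
    simpa [hp, -List.get_eq_getElem] using this
  · have ho : Node.origin A (.andRel m c) i = .inr (.res _) := dif_neg hp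
    rw [ho] at hi
    have := hr.symm.trans hi
    simp_all

/-- The output variable follows the demand of a high-level controller, unless two demands clash. -/
theorem output_of_control (hc : (controller φ A).Cycle x s p s') {y : O → Bool}
    (hy : ∀ v, p (Sum.inr (Sum.inl v)) = some (y v))
    (hclash : ∀ v, ¬ ∃ i j : φ.Demands v,
      resInput φ A p v i = some true ∧ resInput φ A p v j = some false)
    {m : Fin φ.k} {l : OutLit O} (hl : (φ.η m).target = some l) {b : Bool}
    (hb : nodeValue p (Node.control φ m (Pattern.kind_ne_of_target hl)) = some b) :
    y l.var = (b == l.pos) := by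
  obtain ⟨v, pos⟩ := l
  have hin : resInput φ A p v ⟨m, pos, hl⟩ = some (b == pos) := by
    refine (input_eq hc (.res v) _).trans ?_
    cases pos with
    | false =>
      have ho : Node.origin A (.res v) (⟨m, false, hl⟩ : φ.Demands v) = .inr (.negOut m v hl) :=
        dif_pos hl
      rw [ho]
      refine (negOut_eq hc m v hl).trans ?_
      rw [hb]
      simp
    | true =>
      have ho : Node.origin A (.res v) (⟨m, true, hl⟩ : φ.Demands v) =
          .inr (Node.control φ m (Pattern.kind_ne_of_target hl)) :=
        dif_neg (by simp [hl])
      rw [ho]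
      refine hb.trans ?_
      simp
  have hres : nodeValue p (.res v) = some (b == pos) := by
    rw [nodeValue_eq hc]
    refine resActor_out_of_input (A v) _ _ _ ?_ ((input_eq hc (.res v) _).symm.trans hin)
    rintro ⟨i, j, hi, hj⟩
    exact hclash v ⟨i, j, (input_eq hc (.res v) i).trans hi, (input_eq hc (.res v) j).trans hj⟩
  exact Option.some.inj ((hy v).symm.trans ((output_eq hc v).trans hres))

end Cycle

/-! ### Runs of the generated controller -/

section Run

variable {a : ℕ → I → Bool} {s : ℕ → (controller φ A).GState}
  {p : ℕ → (controller φ A).Port → Sig}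

open scoped Classical in
theorem monIn_eq (hrun : (controller φ A).IsRun a s p) (m : Fin φ.k)
    (c : Fin (φ.η m).inClauses.length) (t : ℕ) : nodeValue (p t) (.monIn m c) =
      if (φ.η m).inLevel ((φ.η m).inClauses.get c) ≤ t then
        some (decide (((φ.η m).inClauses.get c).HoldsAt a
          (t - (φ.η m).inLevel ((φ.η m).inClauses.get c))))
      else if (φ.η m).kind = .p4 then none else some false := by
  rw [nodeValue_eq (hrun.cycle t)]
  exact monitor_out (s := fun t => s t (.monIn m c))
    (fun l hl => Pattern.depth_le_inLevel _ (List.get_mem _ _) hl)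
    (hrun.init _) (fun t => next_eq (hrun.cycle t) (.monIn m c)) t _

theorem monRel_eq_true (hrun : (controller φ A).IsRun a s p) (m : Fin φ.k)
    (c : Fin (φ.η m).relInClauses.length) (t : ℕ) :
    nodeValue (p t) (.monRel m c) = some true ↔ ((φ.η m).relInClauses.get c).depth ≤ t ∧
      ((φ.η m).relInClauses.get c).HoldsAt a (t - ((φ.η m).relInClauses.get c).depth) := by
  classical
  rw [nodeValue_eq (hrun.cycle t)]
  refine (Eq.congr_left (monitor_out (s := fun t => s t (.monRel m c))
    (fun l hl => Lit.depth_le_clause hl)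
    (hrun.init _) (fun t => next_eq (hrun.cycle t) (.monRel m c)) t _)).trans ?_
  split_ifs with h <;> simp [h, -List.get_eq_getElem]

/-- The OR-gate of the input part reports that some clause has held at the position that the monitor
of this clause looks at. -/
theorem orIn_eq_true_iff (hrun : (controller φ A).IsRun a s p) (m : Fin φ.k)
    (h : (φ.η m).kind ≠ .p5) (t : ℕ) : nodeValue (p t) (.orIn m h) = some true ↔
      ∃ c ∈ (φ.η m).inClauses, (φ.η m).inLevel c ≤ t ∧
        c.HoldsAt a (t - (φ.η m).inLevel c) := by
  have hmon : ∀ c, nodeValue (p t) (.monIn m c) = some true ↔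
      (φ.η m).inLevel ((φ.η m).inClauses.get c) ≤ t ∧ ((φ.η m).inClauses.get c).HoldsAt a
        (t - (φ.η m).inLevel ((φ.η m).inClauses.get c)) := by
    intro c
    rw [monIn_eq hrun]
    split_ifs with h₁ h₂ <;> simp [h₁, -List.get_eq_getElem]
  rw [orIn_eq_true (hrun.cycle t), exists_congr hmon]
  constructor
  · rintro ⟨c, hc⟩
    exact ⟨_, List.get_mem _ c, hc⟩
  · rintro ⟨c, hc, h'⟩
    obtain ⟨n, rfl⟩ := List.mem_iff_get.mp hc
    exact ⟨n, h'⟩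

theorem orIn_ne_none_of_le (hrun : (controller φ A).IsRun a s p) (m : Fin φ.k)
    (h : (φ.η m).kind ≠ .p5) {t : ℕ} (ht : ∀ c ∈ (φ.η m).inClauses, (φ.η m).inLevel c ≤ t) :
    nodeValue (p t) (.orIn m h) ≠ none := by
  classical
  refine orIn_ne_none (hrun.cycle t) m h fun c => ?_
  rw [monIn_eq hrun, if_pos (ht _ (List.get_mem _ c))]
  simp

/-- A clause over input variables that releases the trigger-until actor, although this actor has been
triggered at position `u`, has held at a position from `u` on: the phase adjustment actor has
suppressed the reports about earlier positions. -/
theorem exists_holdsAt_of_release (hrun : (controller φ A).IsRun a s p) {m : Fin φ.k}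
    (hk : (φ.η m).kind = .p2) {u t : ℕ} (hut : u ≤ t)
    (hu : nodeValue (p u) (.orIn m (Kind.p2_ne hk)) = some true)
    (c : Fin (φ.η m).relInClauses.length)
    (hrel : originValue (a t) (p t) (Node.origin A (.orRel m hk) (Sum.inl c)) = some true) :
    ∃ r, u ≤ r ∧ r ≤ t ∧ ((φ.η m).relInClauses.get c).HoldsAt a r := by
  by_cases hd : ((φ.η m).relInClauses.get c).depth ≠ 0
  · have ho : Node.origin A (.orRel m hk) (Sum.inl c) = .inr (.theta m c hd) := dif_pos hd
    rw [ho] at hrel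
    replace hrel := (nodeValue_eq (hrun.cycle t) (.theta m c hd)).symm.trans hrel
    rcases lt_or_ge t (u + ((φ.η m).relInClauses.get c).depth) with hlt | hge
    · have hfalse := thetaActor_out_eq_false (s := fun t => s t (.theta m c hd))
        (fun t => next_eq (hrun.cycle t) (.theta m c hd)) hut hlt hu ()
      exact absurd (hrel.symm.trans hfalse) (by simp)
    -- The report concerns position `t - depth`, which is not before the trigger.
    · have hmon := (monRel_eq_true hrun m c t).mp (thetaActor_input_eq_true _ _ _ hrel)
      exact ⟨_, by omega, Nat.sub_le _ _, hmon.2⟩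
  · have ho : Node.origin A (.orRel m hk) (Sum.inl c) = .inr (.monRel m c) := dif_neg hd
    rw [ho] at hrel
    have hmon := ((monRel_eq_true hrun m c t).mp hrel).2
    rw [not_not.mp hd] at hmon
    exact ⟨t, hut, le_rfl, hmon⟩

/-- If the monitors have the common level `i`, then the OR-gate of the input part reports in cycle
`t + i` whether the input part holds at position `t`. -/
theorem orIn_eq_true_iff_satAt (hrun : (controller φ A).IsRun a s p) {m : Fin φ.k} {i : ℕ}
    {inp : DNF I i} (hcl : (φ.η m).inClauses = inp.clauses) (hlev : ∀ c, (φ.η m).inLevel c = i)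
    (h : (φ.η m).kind ≠ .p5) (b : ℕ → O → Bool) (t : ℕ) :
    nodeValue (p (t + i)) (.orIn m h) = some true ↔
      LTL.SatAt (ActorSystem.word a b) (inp.toLTL Sum.inl) t := by
  rw [orIn_eq_true_iff hrun, DNF.satAt_toLTL]
  simp only [hcl, hlev, Nat.le_add_left, Nat.add_sub_cancel, true_and]
  rfl

variable {b : ℕ → O → Bool}

/-- The target literal holds exactly if the demand of its specification is `true`; a demand of `false`
is possible only for P4 and enforces the negated literal. -/
theorem satAt_target (hrun : (controller φ A).IsRun a s p)
    (hy : ∀ t v, p t (Sum.inr (Sum.inl v)) = some (b t v))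
    (hclash : ∀ t v, ¬ ∃ i j : φ.Demands v,
      resInput φ A (p t) v i = some true ∧ resInput φ A (p t) v j = some false)
    {m : Fin φ.k} {l : OutLit O} (hl : (φ.η m).target = some l) {t : ℕ} {d : Bool}
    (hd : nodeValue (p t) (Node.control φ m (Pattern.kind_ne_of_target hl)) = some d) :
    LTL.SatAt (ActorSystem.word a b) (l.toLTL Sum.inr) t ↔ d = true := by
  rw [OutLit.satAt_toLTL]
  refine (Eq.congr_left (output_of_control (hrun.cycle t) (hy t) (hclash t) hl hd)).trans ?_
  cases d <;> cases l.pos <;> simp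

theorem sat_P1 (hrun : (controller φ A).IsRun a s p)
    (hy : ∀ t v, p t (Sum.inr (Sum.inl v)) = some (b t v))
    (hclash : ∀ t v, ¬ ∃ i j : φ.Demands v,
      resInput φ A (p t) v i = some true ∧ resInput φ A (p t) v j = some false)
    {m : Fin φ.k} {i : ℕ} {out : OutLit O} {inp : DNF I i} (hm : φ.η m = .P1 out inp) :
    LTL.Sat (ActorSystem.word a b) (Pattern.P1 out inp).toLTL := by
  have hk : (φ.η m).kind = .p1 := by rw [hm]; rfl
  have hcl : (φ.η m).inClauses = inp.clauses := by rw [hm]; rfl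
  have hl : (φ.η m).target = some out := by rw [hm]; rfl
  refine LTL.satAt_W_of_forall fun t _ hno => ?_
  refine (satAt_target hrun hy hclash hl (d := true) ?_).mpr rfl
  rw [Node.control_p1 hk, nodeValue_eq (hrun.cycle t)]
  refine inUB_out_eq_true (s := fun t => s t (.inUB m hk))
    (i := fun t i => originValue (a t) (p t) (Node.origin A (.inUB m hk) i))
    (hrun.init _) (fun t => next_eq (hrun.cycle t) _) t (fun r hr hin => ?_) _
  obtain ⟨c, hc, -, hholds⟩ := (orIn_eq_true_iff hrun m (Kind.p1_ne hk) r).mp hin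
  exact hno _ (Nat.zero_le _) ((Nat.sub_le _ _).trans hr)
    ((DNF.satAt_toLTL _ _ _).mpr ⟨c, hcl ▸ hc, hholds⟩)

theorem sat_P2 (hrun : (controller φ A).IsRun a s p)
    (hy : ∀ t v, p t (Sum.inr (Sum.inl v)) = some (b t v))
    (hclash : ∀ t v, ¬ ∃ i j : φ.Demands v,
      resInput φ A (p t) v i = some true ∧ resInput φ A (p t) v j = some false)
    {m : Fin φ.k} {i j : ℕ} {inp : DNF I i} {out : OutLit O} {relIn : DNF I j} {relOut : DNF O 0}
    (hm : φ.η m = .P2 inp out relIn relOut) :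
    LTL.Sat (ActorSystem.word a b) (Pattern.P2 inp out relIn relOut).toLTL := by
  have hk : (φ.η m).kind = .p2 := by rw [hm]; rfl
  have hcl : (φ.η m).inClauses = inp.clauses := by rw [hm]; rfl
  have hlev : ∀ c, (φ.η m).inLevel c = i := by rw [hm]; exact fun _ => rfl
  have hrelIn : (φ.η m).relInClauses = relIn.clauses := by rw [hm]; rfl
  have hrelOut : (φ.η m).relOutClauses = relOut.clauses := by rw [hm]; rfl
  have hl : (φ.η m).target = some out := by rw [hm]; rfl
  intro t _ hinp
  have htrig := (orIn_eq_true_iff_satAt hrun hcl hlev (Kind.p2_ne hk) b t).mpr hinp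
  rw [LTL.satAt_XN]
  refine LTL.satAt_W_of_forall fun u htu hno => ?_
  refine (satAt_target hrun hy hclash hl (d := true) ?_).mpr rfl
  rw [Node.control_p2 hk, nodeValue_eq (hrun.cycle u)]
  refine trUB_out_eq_true (s := fun t => s t (.trUB m hk))
    (i := fun t i => originValue (a t) (p t) (Node.origin A (.trUB m hk) i))
    (fun t => next_eq (hrun.cycle t) _) htu htrig (fun r htr hru hrel => ?_) _
  replace hrel : nodeValue (p r) (.orRel m hk) = some true := hrel
  rw [nodeValue_eq (hrun.cycle r)] at hrel
  obtain ⟨c | c, hc⟩ := (orGate_out_eq_true _ _ _).mp hrel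
  -- A `true` release signal in cycle `r` would mean a release at a position between trigger and `u`.
  · obtain ⟨q, htq, hqr, hq⟩ := exists_holdsAt_of_release hrun hk htr htrig c hc
    exact hno q htq (hqr.trans hru)
      (Or.inl ((DNF.satAt_toLTL _ _ _).mpr ⟨_, hrelIn ▸ List.get_mem _ c, hq⟩))
  · refine hno r htr hru (Or.inr ((DNF.satAt_toLTL_zero _ _ _).mpr
      ⟨(φ.η m).relOutClauses.get c, by rw [← hrelOut]; exact List.get_mem _ c, ?_⟩))
    exact holds_of_andRel (hrun.cycle r) (hy r) m c hc

theorem sat_P3 (hrun : (controller φ A).IsRun a s p)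
    (hy : ∀ t v, p t (Sum.inr (Sum.inl v)) = some (b t v))
    (hclash : ∀ t v, ¬ ∃ i j : φ.Demands v,
      resInput φ A (p t) v i = some true ∧ resInput φ A (p t) v j = some false)
    {m : Fin φ.k} {i : ℕ} {inp : DNF I i} {out : OutLit O} (hm : φ.η m = .P3 inp out) :
    LTL.Sat (ActorSystem.word a b) (Pattern.P3 inp out).toLTL := by
  have hk : (φ.η m).kind = .p3 := by rw [hm]; rfl
  have hcl : (φ.η m).inClauses = inp.clauses := by rw [hm]; rfl
  have hlev : ∀ c, (φ.η m).inLevel c = i := by rw [hm]; exact fun _ => rfl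
  have hl : (φ.η m).target = some out := by rw [hm]; rfl
  intro t _ hinp
  have htrig := (orIn_eq_true_iff_satAt hrun hcl hlev (Kind.p3_ne hk) b t).mpr hinp
  rw [LTL.satAt_XN]
  refine (satAt_target hrun hy hclash hl (d := true) ?_).mpr rfl
  rw [Node.control_p3 hk, nodeValue_eq (hrun.cycle (t + i))]
  exact if_pos htrig

theorem sat_P4 (hrun : (controller φ A).IsRun a s p)
    (hy : ∀ t v, p t (Sum.inr (Sum.inl v)) = some (b t v))
    (hclash : ∀ t v, ¬ ∃ i j : φ.Demands v,
      resInput φ A (p t) v i = some true ∧ resInput φ A (p t) v j = some false)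
    {m : Fin φ.k} {i : ℕ} {inp : DNF I i} {out : OutLit O} (hm : φ.η m = .P4 inp out) :
    LTL.Sat (ActorSystem.word a b) (Pattern.P4 inp out).toLTL := by
  have hk : (φ.η m).kind = .p4 := by rw [hm]; rfl
  have hcl : (φ.η m).inClauses = inp.clauses := by rw [hm]; rfl
  have hlev : ∀ c, (φ.η m).inLevel c = i := by rw [hm]; exact fun _ => rfl
  have hl : (φ.η m).target = some out := by rw [hm]; rfl
  have hne := Pattern.kind_ne_of_target hl
  intro t _
  suffices h : LTL.SatAt (ActorSystem.word a b) (out.toLTL Sum.inr) (t + i) ↔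
      LTL.SatAt (ActorSystem.word a b) (inp.toLTL Sum.inl) t from
    ⟨fun hinp => (LTL.satAt_XN _ _ _).mpr (h.mpr hinp),
      fun hout => h.mp ((LTL.satAt_XN _ _ _).mp hout)⟩
  obtain ⟨d, hd⟩ := Option.ne_none_iff_exists'.mp
    (orIn_ne_none_of_le hrun m hne (t := t + i) fun c _ => by rw [hlev c]; omega)
  rw [satAt_target hrun hy hclash hl ((congrArg _ (Node.control_p4 hk hne)).trans hd),
    ← orIn_eq_true_iff_satAt hrun hcl hlev hne b t, hd]
  simp

/-- Under the assumption of the specification, each cycle of a run is an instance of the 2QBF formula. -/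
theorem sat_of_qbfWitness (hA : QBFWitness φ A) (hrun : (controller φ A).IsRun a s p)
    (hy : ∀ t v, p t (Sum.inr (Sum.inl v)) = some (b t v)) :
    LTL.Sat (ActorSystem.word a b) φ.toLTL := by
  intro hassume
  have hQ := fun t => hA (a t) (s t) (s (t + 1)) (p t) (b t)
    ((DNF.satAt_toLTL_zero (σ := ActorSystem.word a b) Sum.inl _ t).mp
      (hassume t (Nat.zero_le t))) (hrun.cycle t) (hy t)
  have hclash := fun t => (hQ t).1
  rw [LTL.satAt_conj]
  intro f hf
  obtain ⟨m, rfl⟩ := List.mem_ofFn.mp hf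
  rcases hm : φ.η m with ⟨out, inp⟩ | ⟨inp, out, relIn, relOut⟩ | ⟨inp, out⟩ | ⟨inp, out⟩ | ⟨inv⟩
  · exact sat_P1 hrun hy hclash hm
  · exact sat_P2 hrun hy hclash hm
  · exact sat_P3 hrun hy hclash hm
  · exact sat_P4 hrun hy hclash hm
  · exact fun t _ => (DNF.satAt_toLTL_zero _ _ _).mpr ((hQ t).2 m inv hm)

end Run

end Controller

end GXW

theorem mainTheorem3 {I O : Type} [Finite I] [Finite O]
    (φ : GXW.Spec I O) (S : GXW.ActorSystem I O) (hS : GXW.Generated φ S) :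
    S.Realizes φ.toLTL := by
  obtain ⟨A, rfl, hloop, hA⟩ := hS
  have hwf := hloop.wellFounded
  refine ⟨fun s x => ⟨(GXW.ActorSystem.portValue hwf x s, _),
    GXW.ActorSystem.cycle_portValue hwf x s, fun q hq => ?_⟩, fun a => ?_⟩
  · exact Prod.ext_iff.mpr (hq.eq_of_wellFounded hwf (GXW.ActorSystem.cycle_portValue hwf x s))
  · obtain ⟨s, p, hrun⟩ := GXW.ActorSystem.exists_isRun
      (fun s x => ⟨_, _, GXW.ActorSystem.cycle_portValue hwf x s⟩) a
    have hout : ∀ t v, ∃ d, p t (Sum.inr (Sum.inl v)) = some d := fun t v =>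
      Option.ne_none_iff_exists'.mp fun h => GXW.Controller.res_ne_none (hrun.cycle t) v
        ((GXW.Controller.output_eq (hrun.cycle t) v).symm.trans h)
    choose b hb using hout
    exact ⟨s, p, hrun, b, hb, GXW.Controller.sat_of_qbfWitness hA hrun hb⟩
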